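/- Let $\Omega$ be a non-empty set, $\mathscr A$ an algebra of subsets of $\Omega$ and $m:\mathscr A\to[0,1]$ a finitely additive probability. Let $m^*(E)=\inf\{m(A):A\in\mathscr A,\ E\subset A\}$. A function $g:\Omega\to\mathbb R$ belongs to $L^1(m)$ if there are $\mathscr A$-simple functions $g_n$ with $\lim_n m^*(|g_n-g|>c)=0$ for every $c>0$ and $\lim_{p,q}\int|g_p-g_q|\,dm=0$; then $\int g\,dm=\lim_n\int g_n\,dm$, and $\int_A g\,dm=\int g\mathbf 1_A\,dm$ for $A\in\mathscr A$. Let $X$ be a real Banach space with the Radon-Nikodym property: for every countably additive probability space $(S,\Sigma,\nu)$ and every countably additive $G:\Sigma\to X$ of finite variation with $G\ll\nu$, there is a Bochner $\nu$-integrable $g:S\to X$ such that $G(E)=\int_E g\,d\nu$ for all $E\in\Sigma$. **Theorem.** Let $f:\Omega\to X$ satisfy the following: 1. (norm integrability) $\|f\|\in L^1(m)$; 2. (Pettis integrability) for every $A\in\mathscr A$ there is $x_A\in X$ such that, for all $x^*\in X^*$, $x^*f\mathbf 1_A\in L^1(m)$ and $x^*(x_A)=\int_A x^*f\,dm$; 3.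 (essentially weakly closed range) for every $n\in\mathbb N$ there is $A_n\in\mathscr A$ with $m(A_n^c)<2^{-n}$ such that $f[A_n]$ is weakly closed in $X$. Then there is a countably additive probability $\mu$ on the $\sigma$-algebra $f^{-1}[\mathrm{Bor}(X)]=\{f^{-1}(B):B\subset X \text{ norm Borel}\}$ such that, for every $h:X\to\mathbb R$ which is uniformly continuous for the weak uniformity of $X$ and satisfies $h(f)\in L^1(m)$, $$h(f)\in L^1(\mu)\qquad\text{and}\qquad\int h(f)\,dm=\int h(f)\,d\mu .$$ -/

import Mathlib

open MeasureTheory Set Filter Topology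
open scoped NNReal ENNReal

universe u v

/-! ### Integration of real functions with respect to a finitely additive set function

`𝒜` is an algebra of subsets of `Ω` and `m` a finitely additive, nonnegative set function on `𝒜`;
values of `m` outside `𝒜` are never used. -/

namespace FinAdd

variable {Ω : Type u} {𝒜 : Set (Set Ω)}

/-- The outer measure `m^*(E) = inf {m(A) : A ∈ 𝒜, E ⊆ A}` (the set is non-empty if `Ω ∈ 𝒜`). -/
noncomputable def outer (m : AddContent ℝ≥0 𝒜) (E : Set Ω) : ℝ≥0 :=
  sInf {r | ∃ A ∈ 𝒜, E ⊆ A ∧ r = m A}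

/-- `𝒜`-simple real functions: finite range, level sets in `𝒜`. -/
def IsSimple (𝒜 : Set (Set Ω)) (s : Ω → ℝ) : Prop :=
  (range s).Finite ∧ ∀ r, s ⁻¹' {r} ∈ 𝒜

/-- The integral `∑ r, m(s = r) r` of a simple function. -/
noncomputable def simpleIntegral (m : AddContent ℝ≥0 𝒜) (s : Ω → ℝ) : ℝ :=
  ∑ᶠ r : ℝ, (m (s ⁻¹' {r}) : ℝ) * r

/-- `gₙ` converges to `g` in `m`-measure: `m^*(|gₙ - g| > c) → 0` for all `c > 0`. -/
def ConvergesInMeasure (m : AddContent ℝ≥0 𝒜) (s : ℕ → Ω → ℝ) (g : Ω → ℝ) : Prop :=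
  ∀ c : ℝ, 0 < c → Tendsto (fun n => outer m {ω | c < |s n ω - g ω|}) atTop (𝓝 0)

/-- `s` is a sequence of simple functions that `m`-converges to `g` and is Cauchy in mean,
`∫ |s_p - s_q| dm → 0` as `p, q → ∞`. -/
structure IsDetermining (m : AddContent ℝ≥0 𝒜) (s : ℕ → Ω → ℝ) (g : Ω → ℝ) : Prop where
  simple : ∀ n, IsSimple 𝒜 (s n)
  converges : ConvergesInMeasure m s g
  cauchy : Tendsto (fun p : ℕ × ℕ => simpleIntegral m (fun ω => |s p.1 ω - s p.2 ω|))
    atTop (𝓝 0)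

/-- `g ∈ L¹(m)`. -/
def Integrable (m : AddContent ℝ≥0 𝒜) (g : Ω → ℝ) : Prop :=
  ∃ s, IsDetermining m s g

/-- `g ∈ L¹(m)` and `∫ g dm = I`: the integrals of a determining sequence converge to `I`. -/
def HasIntegral (m : AddContent ℝ≥0 𝒜) (g : Ω → ℝ) (I : ℝ) : Prop :=
  ∃ s, IsDetermining m s g ∧ Tendsto (fun n => simpleIntegral m (s n)) atTop (𝓝 I)

variable {X : Type v} [NormedAddCommGroup X] [NormedSpace ℝ X]

/-- Over every `A ∈ 𝒜` there is a definite Pettis integral, that is an `x ∈ X` with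
`φ x = ∫_A φ(f) dm` for all `φ ∈ X^*`. -/
def PettisIntegrable (m : AddContent ℝ≥0 𝒜) (f : Ω → X) : Prop :=
  ∀ A ∈ 𝒜, ∃ x : X, ∀ φ : StrongDual ℝ X,
    HasIntegral m (A.indicator fun ω => φ (f ω)) (φ x)

/-- `f` has essentially weakly closed range: for each `n` there is `A ∈ 𝒜` with
`m(Aᶜ) < 2⁻ⁿ` and `f[A]` weakly closed. -/
def EssWeaklyClosedRange (m : AddContent ℝ≥0 𝒜) (f : Ω → X) : Prop :=
  ∀ n : ℕ, ∃ A ∈ 𝒜, m Aᶜ < (2⁻¹ : ℝ≥0) ^ n ∧ IsClosed (toWeakSpace ℝ X '' (f '' A))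

end FinAdd

/-! ### Banach space notions -/

/-- The Radon-Nikodym property: every countably additive `X`-valued measure of finite
variation that is absolutely continuous with respect to a countably additive probability has a
Bochner integrable density. -/
def HasRNP (X : Type v) [NormedAddCommGroup X] [NormedSpace ℝ X] : Prop :=
  ∀ (S : Type u) [MeasurableSpace S] (ν : Measure S) [IsProbabilityMeasure ν]
    (G : VectorMeasure S X), G.variation univ < ∞ → G ≪ᵥ ν.toENNRealVectorMeasure →
    ∃ g : S → X, Integrable g ν ∧ ∀ E, MeasurableSet E → G E = ∫ s in E, g s ∂ν

/-- Uniform continuity of `h : X → ℝ` on `(X, weak)`, for the uniformity of the additive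
topological group `WeakSpace ℝ X`. -/
def WeakUniformContinuous {X : Type v} [NormedAddCommGroup X] [NormedSpace ℝ X]
    (h : X → ℝ) : Prop :=
  letI : UniformSpace (WeakSpace ℝ X) := IsTopologicalAddGroup.rightUniformSpace _
  UniformContinuous fun x : WeakSpace ℝ X => h ((toWeakSpace ℝ X).symm x)

/-! Finite additivity is removed by moving to the compact space of ultrafilters on `Ω`. By
compactness, `m` becomes a countably additive `P` on the σ-algebra generated by the clopen sets `cyl
A`. An `m`-integrable `u` converges along `P`-almost every ultrafilter, and its limit `hat u` has
the same integral (`IsDetermining.hat`). The Pettis integrals of `f`, dominated by the integral of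
`hat ‖f‖`, extend to an `X`-valued measure of finite variation. The Radon-Nikodym property gives it
a density `g`, so for each `φ` one has `φ (f ω) → φ (g σ)` along almost every `σ`
(`PettisIntegrable.exists_tendsto`). The null set depends on `φ`. Weak uniform continuity of `h`
involves only countably many functionals, hence `hat (h ∘ f) = h ∘ g` almost everywhere. Weakly
closed images trap the weak limits, so `g` takes almost all its values in `f[Ω]` and lifts to a map
`κ` into `Ω` with `f ∘ κ = g` almost everywhere. The measure sought is the image of `P` under `κ`.
-/

namespace FinAdd

/-! ### Countably additive extension on the space of ultrafilters -/

section Stone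

variable {Ω : Type u} {𝒜 : Set (Set Ω)}

/-- The clopen set of ultrafilters containing `A`. -/
def cyl (A : Set Ω) : Set (Ultrafilter Ω) := {σ | A ∈ σ}

@[simp] lemma mem_cyl {A : Set Ω} {σ : Ultrafilter Ω} : σ ∈ cyl A ↔ A ∈ σ := Iff.rfl

@[simp] lemma pure_preimage_cyl (A : Set Ω) : pure ⁻¹' cyl A = A := by
  ext; simp [cyl]

lemma cyl_empty : cyl (∅ : Set Ω) = ∅ := by ext; simp

lemma cyl_union (A B : Set Ω) : cyl (A ∪ B) = cyl A ∪ cyl B := by ext; simp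

lemma cyl_compl (A : Set Ω) : cyl Aᶜ = (cyl A)ᶜ := by
  ext; simp [Ultrafilter.compl_mem_iff_notMem]

lemma cyl_univ : cyl (univ : Set Ω) = univ :=
  eq_univ_of_forall fun _ => Filter.univ_mem

lemma isSetAlgebra_cyl (h𝒜 : IsSetAlgebra 𝒜) : IsSetAlgebra (cyl '' 𝒜) where
  empty_mem := ⟨∅, h𝒜.empty_mem, cyl_empty⟩
  compl_mem := by
    rintro _ ⟨A, hA, rfl⟩
    exact ⟨Aᶜ, h𝒜.compl_mem hA, cyl_compl A⟩
  union_mem := by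
    rintro _ _ ⟨A, hA, rfl⟩ ⟨B, hB, rfl⟩
    exact ⟨A ∪ B, h𝒜.union_mem hA hB, cyl_union A B⟩

/-- The content induced on the algebra of clopen sets `cyl A`, `A ∈ 𝒜`. -/
noncomputable def stoneContent (h𝒜 : IsSetAlgebra 𝒜) (m : AddContent ℝ≥0 𝒜) :
    AddContent ℝ≥0∞ (cyl '' 𝒜) :=
  (isSetAlgebra_cyl h𝒜).isSetRing.addContent_of_union
    (fun E => (m (pure ⁻¹' E) : ℝ≥0∞)) (by simp) (by
      rintro _ _ ⟨A, hA, rfl⟩ ⟨B, hB, rfl⟩ hd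
      have : Disjoint A B := by
        have := hd.preimage (pure : Ω → Ultrafilter Ω)
        simpa using this
      rw [preimage_union, pure_preimage_cyl, pure_preimage_cyl,
        addContent_union h𝒜.isSetRing hA hB this]
      simp)

lemma stoneContent_cyl (h𝒜 : IsSetAlgebra 𝒜) (m : AddContent ℝ≥0 𝒜) (A : Set Ω) :
    stoneContent h𝒜 m (cyl A) = m A := by
  change ((m (pure ⁻¹' cyl A) : ℝ≥0) : ℝ≥0∞) = _
  simp

/-- The sets `cyl A` are clopen in a compact space, so a countable cover of one by others has a
finite subcover and finite subadditivity suffices. -/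
lemma stoneContent_isSigmaSubadditive (h𝒜 : IsSetAlgebra 𝒜) (m : AddContent ℝ≥0 𝒜) :
    (stoneContent h𝒜 m).IsSigmaSubadditive := by
  intro E hE hU
  have hcl : IsCompact (⋃ i, E i) := by
    obtain ⟨A, -, hA⟩ := hU
    rw [← hA]
    exact (ultrafilter_isClosed_basic A).isCompact
  have hop (i) : IsOpen (E i) := by
    obtain ⟨A, -, hA⟩ := hE i
    rw [← hA]
    exact ultrafilter_isOpen_basic A
  obtain ⟨t, ht⟩ := hcl.elim_finite_subcover E hop subset_rfl
  have hR := (isSetAlgebra_cyl h𝒜).isSetRing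
  calc stoneContent h𝒜 m (⋃ i, E i) ≤ stoneContent h𝒜 m (⋃ i ∈ t, E i) :=
        addContent_mono hR.isSetSemiring hU (hR.biUnion_mem t fun i _ => hE i) ht
    _ ≤ ∑ i ∈ t, stoneContent h𝒜 m (E i) := addContent_biUnion_le hR fun i _ => hE i
    _ ≤ ∑' i, stoneContent h𝒜 m (E i) := ENNReal.sum_le_tsum t

/-- `P` is the countably additive extension of `m` to the σ-algebra generated by the clopen sets
`cyl A`, `A ∈ 𝒜`. -/
structure IsStoneMeasure [mS : MeasurableSpace (Ultrafilter Ω)] (m : AddContent ℝ≥0 𝒜)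
    (P : Measure (Ultrafilter Ω)) : Prop where
  generate : mS = MeasurableSpace.generateFrom (cyl '' 𝒜)
  measure_cyl : ∀ A ∈ 𝒜, P (cyl A) = m A

lemma exists_isStoneMeasure (h𝒜 : IsSetAlgebra 𝒜) (m : AddContent ℝ≥0 𝒜) :
    ∃ (_ : MeasurableSpace (Ultrafilter Ω)) (P : Measure (Ultrafilter Ω)),
      IsStoneMeasure m P := by
  let _ := MeasurableSpace.generateFrom (cyl '' 𝒜)
  have hC := (isSetAlgebra_cyl h𝒜).isSetRing.isSetSemiring
  refine ⟨_, (stoneContent h𝒜 m).measure hC le_rfl (stoneContent_isSigmaSubadditive h𝒜 m), rfl,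
    fun A hA => ?_⟩
  rw [AddContent.measure_eq _ hC rfl _ ⟨A, hA, rfl⟩, stoneContent_cyl]

lemma IsStoneMeasure.measurableSet_cyl [MeasurableSpace (Ultrafilter Ω)] {m : AddContent ℝ≥0 𝒜}
    {P : Measure (Ultrafilter Ω)} (hP : IsStoneMeasure m P) {A : Set Ω} (hA : A ∈ 𝒜) :
    MeasurableSet (cyl A) := by
  rw [hP.generate]
  exact MeasurableSpace.measurableSet_generateFrom ⟨A, hA, rfl⟩

lemma IsStoneMeasure.isProbabilityMeasure [MeasurableSpace (Ultrafilter Ω)]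
    {m : AddContent ℝ≥0 𝒜} {P : Measure (Ultrafilter Ω)} (hP : IsStoneMeasure m P)
    (h𝒜 : IsSetAlgebra 𝒜) (hm : m univ = 1) : IsProbabilityMeasure P :=
  ⟨by rw [← cyl_univ, hP.measure_cyl _ h𝒜.univ_mem, hm]; simp⟩

lemma HasIntegral.integrable {m : AddContent ℝ≥0 𝒜} {u : Ω → ℝ} {I : ℝ} (h : HasIntegral m u I) :
    Integrable m u :=
  let ⟨s, hs, _⟩ := h
  ⟨s, hs⟩

lemma exists_mem_of_outer_lt (h𝒜 : IsSetAlgebra 𝒜) {m : AddContent ℝ≥0 𝒜} {E : Set Ω} {r : ℝ≥0}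
    (h : outer m E < r) :
    ∃ A ∈ 𝒜, E ⊆ A ∧ m A < r := by
  obtain ⟨_, ⟨A, hA, hE, rfl⟩, hlt⟩ :=
    exists_lt_of_csInf_lt (s := {r | ∃ A ∈ 𝒜, E ⊆ A ∧ r = m A})
      ⟨m univ, univ, h𝒜.univ_mem, subset_univ _, rfl⟩ h
  exact ⟨A, hA, hE, hlt⟩

end Stone

/-! ### Simple functions and their limits along ultrafilters -/

section Simple

variable {Ω : Type u} {𝒜 : Set (Set Ω)}

lemma IsSimple.preimage_mem (h𝒜 : IsSetAlgebra 𝒜) {s : Ω → ℝ} (hs : IsSimple 𝒜 s) (T : Set ℝ) :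
    s ⁻¹' T ∈ 𝒜 := by
  classical
  have : s ⁻¹' T = ⋃ r ∈ hs.1.toFinset.filter (· ∈ T), s ⁻¹' {r} := by
    ext ω; simp
  rw [this]
  exact h𝒜.biUnion_mem _ fun r _ => hs.2 r

lemma IsSimple.map₂ (h𝒜 : IsSetAlgebra 𝒜) {s t : Ω → ℝ} (hs : IsSimple 𝒜 s) (ht : IsSimple 𝒜 t)
    (F : ℝ → ℝ → ℝ) : IsSimple 𝒜 fun ω => F (s ω) (t ω) := by
  classical
  refine ⟨(hs.1.image2 F ht.1).subset ?_, fun r => ?_⟩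
  · rintro _ ⟨ω, rfl⟩
    exact ⟨_, ⟨ω, rfl⟩, _, ⟨ω, rfl⟩, rfl⟩
  · have : (fun ω => F (s ω) (t ω)) ⁻¹' {r} =
        ⋃ a ∈ hs.1.toFinset, (s ⁻¹' {a} ∩ t ⁻¹' {b | F a b = r}) := by
      ext ω
      simp only [mem_preimage, mem_singleton_iff, Finite.mem_toFinset, mem_iUnion, mem_inter_iff,
        mem_ofPred_eq, exists_prop]
      exact ⟨fun h => ⟨s ω, ⟨ω, rfl⟩, rfl, h⟩, by rintro ⟨_, -, rfl, h⟩; exact h⟩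
    rw [this]
    exact h𝒜.biUnion_mem _ fun a _ => h𝒜.inter_mem (hs.2 a) (ht.preimage_mem h𝒜 _)

/-- The limit of `u` along ultrafilters. -/
noncomputable def hat (u : Ω → ℝ) (σ : Ultrafilter Ω) : ℝ := limUnder (σ : Filter Ω) u

lemma hat_eq {u : Ω → ℝ} {σ : Ultrafilter Ω} {r : ℝ} (h : Tendsto u (σ : Filter Ω) (𝓝 r)) :
    hat u σ = r :=
  h.limUnder_eq

lemma IsSimple.exists_mem {s : Ω → ℝ} (hs : IsSimple 𝒜 s) (σ : Ultrafilter Ω) :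
    ∃ r ∈ range s, s ⁻¹' {r} ∈ σ := by
  have h : (⋃ r ∈ range s, s ⁻¹' {r}) ∈ σ := by
    convert! (Filter.univ_mem : (univ : Set Ω) ∈ (σ : Filter Ω))
    ext; simp
  exact (Ultrafilter.finite_biUnion_mem_iff hs.1).1 h

lemma hat_eq_of_mem {s : Ω → ℝ} {σ : Ultrafilter Ω} {r : ℝ} (h : s ⁻¹' {r} ∈ σ) :
    hat s σ = r :=
  hat_eq (tendsto_const_nhds.congr' (Filter.mem_of_superset h fun _ hω => Eq.symm hω))

lemma IsSimple.preimage_hat_mem {s : Ω → ℝ} (hs : IsSimple 𝒜 s) (σ : Ultrafilter Ω) :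
    s ⁻¹' {hat s σ} ∈ σ := by
  obtain ⟨r, -, hr⟩ := hs.exists_mem σ
  rwa [hat_eq_of_mem hr]

lemma IsSimple.hat_map₂ {s t : Ω → ℝ} (hs : IsSimple 𝒜 s) (ht : IsSimple 𝒜 t)
    (F : ℝ → ℝ → ℝ) (σ : Ultrafilter Ω) :
    hat (fun ω => F (s ω) (t ω)) σ = F (hat s σ) (hat t σ) := by
  apply hat_eq_of_mem
  filter_upwards [hs.preimage_hat_mem σ, ht.preimage_hat_mem σ] with ω h1 h2
  simp only [mem_preimage, mem_singleton_iff] at *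
  rw [h1, h2]

lemma IsSimple.hat_preimage {s : Ω → ℝ} (hs : IsSimple 𝒜 s) (r : ℝ) :
    hat s ⁻¹' {r} = cyl (s ⁻¹' {r}) := by
  ext σ
  refine ⟨fun h => ?_, fun h => hat_eq_of_mem h⟩
  have := hs.preimage_hat_mem σ
  rwa [show hat s σ = r from h] at this

lemma IsSimple.range_hat_subset {s : Ω → ℝ} (hs : IsSimple 𝒜 s) : range (hat s) ⊆ range s := by
  rintro _ ⟨σ, rfl⟩
  obtain ⟨r, hr, h⟩ := hs.exists_mem σ
  rwa [hat_eq_of_mem h]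

variable [MeasurableSpace (Ultrafilter Ω)] {m : AddContent ℝ≥0 𝒜} {P : Measure (Ultrafilter Ω)}

/-- The limit of a simple function along ultrafilters, as a simple function. -/
noncomputable def IsStoneMeasure.simpleFunc (hP : IsStoneMeasure m P) {s : Ω → ℝ}
    (hs : IsSimple 𝒜 s) : SimpleFunc (Ultrafilter Ω) ℝ where
  toFun := hat s
  measurableSet_fiber' r := by
    rw [hs.hat_preimage]
    exact hP.measurableSet_cyl (hs.2 r)
  finite_range' := hs.1.subset hs.range_hat_subset

lemma IsStoneMeasure.integrable_hat_simple [IsFiniteMeasure P] (hP : IsStoneMeasure m P)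
    {s : Ω → ℝ} (hs : IsSimple 𝒜 s) : MeasureTheory.Integrable (hat s) P :=
  (hP.simpleFunc hs).integrable_of_isFiniteMeasure

lemma IsStoneMeasure.integral_hat_simple [IsFiniteMeasure P] (hP : IsStoneMeasure m P)
    {s : Ω → ℝ} (hs : IsSimple 𝒜 s) : ∫ σ, hat s σ ∂P = simpleIntegral m s := by
  classical
  have h1 : ∫ σ, hat s σ ∂P = (hP.simpleFunc hs).integral P :=
    ((hP.simpleFunc hs).integral_eq_integral (hP.integrable_hat_simple hs)).symm
  rw [h1, SimpleFunc.integral_eq_sum_of_subset (s := hs.1.toFinset), simpleIntegral,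
    finsum_eq_sum_of_support_subset (s := hs.1.toFinset)]
  · refine Finset.sum_congr rfl fun r _ => ?_
    have : (hP.simpleFunc hs : Ultrafilter Ω → ℝ) ⁻¹' {r} = cyl (s ⁻¹' {r}) := hs.hat_preimage r
    rw [this, measureReal_def, hP.measure_cyl _ (hs.2 r)]
    simp
  · intro r hr
    by_contra h
    have : s ⁻¹' {r} = ∅ := by
      ext ω
      simp only [Finite.coe_toFinset, mem_range, not_exists] at h
      simpa using h ω
    simp [this] at hr
  · intro r hr
    simp only [Finset.mem_filter, SimpleFunc.mem_range] at hr
    simpa using hs.range_hat_subset hr.1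

end Simple

/-! ### Transfer of the integral from `m` to `P` -/

section Determining

variable {Ω : Type u} {𝒜 : Set (Set Ω)} [MeasurableSpace (Ultrafilter Ω)]
  {m : AddContent ℝ≥0 𝒜} {P : Measure (Ultrafilter Ω)}

/-- Convergence in `m`-measure transfers to pointwise convergence along almost every ultrafilter. -/
lemma IsStoneMeasure.ae_tendsto (h𝒜 : IsSetAlgebra 𝒜) (hP : IsStoneMeasure m P) {s : ℕ → Ω → ℝ}
    {u : Ω → ℝ} (hs : ∀ n, IsSimple 𝒜 (s n)) (hu : ConvergesInMeasure m s u)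
    {U : Ultrafilter Ω → ℝ}
    (hU : ∀ᵐ σ : Ultrafilter Ω ∂P, Tendsto (fun n => hat (s n) σ) atTop (𝓝 (U σ))) :
    ∀ᵐ σ : Ultrafilter Ω ∂P, Tendsto u (σ : Filter Ω) (𝓝 (U σ)) := by
  -- Tolerance and exceptional mass are both `2⁻ᵏ` along a subsequence, so that Borel-Cantelli
  -- applies to the sets `cyl (B k)`.
  have hev (k : ℕ) : ∀ᶠ n in atTop,
      outer m {ω | (2⁻¹ : ℝ) ^ k < |s n ω - u ω|} < (2⁻¹ : ℝ≥0) ^ k :=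
    (hu _ (by positivity)).eventually_lt_const (by positivity)
  obtain ⟨n, hn, hlt⟩ := extraction_forall_of_eventually hev
  choose B hB hsub hmB using fun k => exists_mem_of_outer_lt h𝒜 (hlt k)
  have hsum : ∑' k, P (cyl (B k)) ≠ ∞ := by
    refine ne_top_of_le_ne_top (b := ∑' k : ℕ, (((2⁻¹ : ℝ≥0) ^ k : ℝ≥0) : ℝ≥0∞)) ?_ ?_
    · rw [ENNReal.tsum_coe_ne_top_iff_summable]
      exact NNReal.summable_geometric (by rw [← NNReal.coe_lt_coe]; norm_num)
    · refine ENNReal.tsum_le_tsum fun k => ?_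
      rw [hP.measure_cyl _ (hB k)]
      exact_mod_cast (hmB k).le
  filter_upwards [ae_eventually_notMem hsum, hU] with σ hσ hUσ
  have h2 := hUσ.comp hn.tendsto_atTop
  have h3 : Tendsto (fun k : ℕ => (2⁻¹ : ℝ) ^ k) atTop (𝓝 0) :=
    tendsto_pow_atTop_nhds_zero_of_lt_one (by norm_num) (by norm_num)
  rw [Metric.tendsto_nhds]
  intro ε hε
  obtain ⟨k, hk1, hk2, hk3⟩ := (hσ.and ((Metric.tendsto_nhds.1 h2 (ε / 2) (by positivity)).and
    (h3.eventually_lt_const (by positivity : 0 < ε / 2)))).exists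
  have hk1' : (B k)ᶜ ∈ σ := Ultrafilter.compl_mem_iff_notMem.2 hk1
  -- A simple function is constant on some member of `σ`, with value its limit, so a single good
  -- index `k` controls `u` near `σ`.
  filter_upwards [hk1', (hs (n k)).preimage_hat_mem σ] with ω h4 h5
  have h6 : |s (n k) ω - u ω| ≤ 2⁻¹ ^ k := not_lt.1 fun h => h4 (hsub k h)
  have h7 : s (n k) ω = hat (s (n k)) σ := h5
  rw [h7] at h6
  simp only [Function.comp_apply, Real.dist_eq] at hk2
  rw [Real.dist_eq]
  rw [abs_lt] at *
  rw [abs_le] at h6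
  constructor <;> linarith

variable [IsFiniteMeasure P]

/-- An `m`-integrable function converges along almost every ultrafilter, to an integrable limit. -/
lemma IsDetermining.hat (h𝒜 : IsSetAlgebra 𝒜) (hP : IsStoneMeasure m P) {s : ℕ → Ω → ℝ}
    {u : Ω → ℝ} (hs : IsDetermining m s u) :
    MeasureTheory.Integrable (hat u) P ∧
      (∀ᵐ σ : Ultrafilter Ω ∂P, Tendsto u (σ : Filter Ω) (𝓝 (hat u σ))) ∧
      Tendsto (fun n => simpleIntegral m (s n)) atTop (𝓝 (∫ σ, hat u σ ∂P)) := by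
  have hI (n) := hP.integrable_hat_simple (hs.simple n)
  -- Being Cauchy in mean is being Cauchy in `L¹(P)`, whose completeness supplies the limit `F`.
  have hd (p q) : dist ((hI p).toL1 _) ((hI q).toL1 _) =
      simpleIntegral m (fun ω => |s p ω - s q ω|) := by
    have hpq := (hs.simple p).map₂ h𝒜 (hs.simple q) (fun a b => |a - b|)
    rw [dist_eq_norm, ← Integrable.toL1_sub, L1.norm_of_fun_eq_integral_norm,
      ← hP.integral_hat_simple hpq]
    congr 1 with σ
    rw [(hs.simple p).hat_map₂ (hs.simple q) (fun a b => |a - b|)]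
    rfl
  have hC : CauchySeq fun n => (hI n).toL1 _ := by
    rw [Metric.cauchySeq_iff]
    intro ε hε
    obtain ⟨N, hN⟩ := eventually_atTop.1 (hs.cauchy.eventually_lt_const hε)
    refine ⟨max N.1 N.2, fun p hp q hq => ?_⟩
    rw [hd]
    exact hN (p, q) ⟨(le_max_left _ _).trans hp, (le_max_right _ _).trans hq⟩
  obtain ⟨F, hF⟩ := cauchySeq_tendsto_of_complete hC
  obtain ⟨n, hn, hnF⟩ := (tendstoInMeasure_of_tendsto_Lp hF).exists_seq_tendsto_ae
  have hae : ∀ᵐ σ : Ultrafilter Ω ∂P, Tendsto (fun k => FinAdd.hat (s (n k)) σ) atTop (𝓝 (F σ)) := by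
    have h1 : ∀ᵐ σ : Ultrafilter Ω ∂P, ∀ k, (hI k).toL1 _ σ = FinAdd.hat (s k) σ :=
      ae_all_iff.2 fun k => (hI k).coeFn_toL1
    filter_upwards [hnF, h1] with σ h2 h3
    simpa only [h3] using h2
  have hlim : ∀ᵐ σ : Ultrafilter Ω ∂P, Tendsto u (σ : Filter Ω) (𝓝 (F σ)) :=
    hP.ae_tendsto h𝒜 (fun k => hs.simple (n k))
      (fun c hc => (hs.converges c hc).comp hn.tendsto_atTop) hae
  have heq : F =ᵐ[P] FinAdd.hat u := by
    filter_upwards [hlim] with σ hσ using (hat_eq hσ).symm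
  refine ⟨(L1.integrable_coeFn F).congr heq, ?_, ?_⟩
  · filter_upwards [hlim, heq] with σ h1 h2
    rwa [← h2]
  · rw [← integral_congr_ae heq]
    convert! (continuous_integral.tendsto F).comp hF using 2 with k
    rw [Function.comp_apply, integral_congr_ae (hI k).coeFn_toL1,
      hP.integral_hat_simple (hs.simple k)]

lemma Integrable.hat (h𝒜 : IsSetAlgebra 𝒜) (hP : IsStoneMeasure m P) {u : Ω → ℝ}
    (hu : Integrable m u) :
    MeasureTheory.Integrable (hat u) P ∧
      (∀ᵐ σ : Ultrafilter Ω ∂P, Tendsto u (σ : Filter Ω) (𝓝 (hat u σ))) ∧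
      HasIntegral m u (∫ σ, hat u σ ∂P) := by
  obtain ⟨s, hs⟩ := hu
  have h := hs.hat h𝒜 hP
  exact ⟨h.1, h.2.1, s, hs, h.2.2⟩

lemma HasIntegral.integral_hat (h𝒜 : IsSetAlgebra 𝒜) (hP : IsStoneMeasure m P) {u : Ω → ℝ}
    {I : ℝ} (h : HasIntegral m u I) : ∫ σ, hat u σ ∂P = I := by
  obtain ⟨s, hs, hI⟩ := h
  exact tendsto_nhds_unique (hs.hat h𝒜 hP).2.2 hI

lemma HasIntegral.setIntegral_hat (h𝒜 : IsSetAlgebra 𝒜) (hP : IsStoneMeasure m P) {u : Ω → ℝ}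
    (hu : Integrable m u) {A : Set Ω} (hA : A ∈ 𝒜) {I : ℝ}
    (h : HasIntegral m (A.indicator u) I) : ∫ σ in cyl A, hat u σ ∂P = I := by
  rw [← h.integral_hat h𝒜 hP, ← integral_indicator (hP.measurableSet_cyl hA)]
  refine integral_congr_ae ?_
  filter_upwards [(hu.hat h𝒜 hP).2.1] with σ hσ
  symm
  by_cases hAσ : A ∈ σ
  · rw [indicator_of_mem (show σ ∈ cyl A from hAσ)]
    refine hat_eq (hσ.congr' ?_)
    filter_upwards [hAσ] with ω hω using (indicator_of_mem hω u).symm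
  · rw [indicator_of_notMem (show σ ∉ cyl A from hAσ)]
    refine hat_eq (tendsto_const_nhds.congr' ?_)
    filter_upwards [Ultrafilter.compl_mem_iff_notMem.2 hAσ] with ω hω
      using (indicator_of_notMem hω u).symm

end Determining

end FinAdd

/-! ### Radon-Nikodym densities from scalar densities -/

section Density

variable {S : Type u} [MeasurableSpace S] {ν : Measure S}
  {X : Type v} [NormedAddCommGroup X] [NormedSpace ℝ X]
  {w : S → ℝ} {Φ : StrongDual ℝ X → S → ℝ}

lemma norm_le_setIntegral_of_forall_dual (hw : Integrable w ν) (hw0 : 0 ≤ᵐ[ν] w)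
    (hb : ∀ φ, ∀ᵐ s ∂ν, |Φ φ s| ≤ ‖φ‖ * w s) {E : Set S} {x : X}
    (hx : ∀ φ : StrongDual ℝ X, φ x = ∫ s in E, Φ φ s ∂ν) : ‖x‖ ≤ ∫ s in E, w s ∂ν := by
  refine NormedSpace.norm_le_dual_bound ℝ x
    (integral_nonneg_of_ae (ae_restrict_of_ae hw0)) fun φ => ?_
  rw [hx φ, mul_comm, ← integral_const_mul]
  exact norm_integral_le_of_norm_le (hw.integrableOn.const_mul _) (ae_restrict_of_ae (hb φ))

variable [CompleteSpace X]

/-- Domination by `w` makes the series absolutely convergent, which turns weak countable additivity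
into norm countable additivity. -/
lemma hasSum_of_forall_dual_setIntegral (hw : Integrable w ν) (hw0 : 0 ≤ᵐ[ν] w)
    (hΦ : ∀ φ, Integrable (Φ φ) ν) (hb : ∀ φ, ∀ᵐ s ∂ν, |Φ φ s| ≤ ‖φ‖ * w s)
    {E : ℕ → Set S} (hE : ∀ i, MeasurableSet (E i)) (hd : Pairwise (Function.onFun Disjoint E))
    {x : ℕ → X} (hx : ∀ i (φ : StrongDual ℝ X), φ (x i) = ∫ s in E i, Φ φ s ∂ν) :
    ∃ y, HasSum x y ∧ ∀ φ : StrongDual ℝ X, φ y = ∫ s in ⋃ i, E i, Φ φ s ∂ν := by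
  have hs : Summable x :=
    Summable.of_norm_bounded (hasSum_integral_iUnion hE hd hw.integrableOn).summable
      fun i => norm_le_setIntegral_of_forall_dual hw hw0 hb (hx i)
  refine ⟨_, hs.hasSum, fun φ => ?_⟩
  have h1 := φ.hasSum hs.hasSum
  have h2 := hasSum_integral_iUnion hE hd (hΦ φ).integrableOn
  simp only [hx] at h1
  exact h1.unique h2

/-- A π-λ argument: complements come from subtraction from the integral over `univ`, disjoint unions
from absolute convergence. -/
lemma exists_forall_dual_setIntegral (hw : Integrable w ν) (hw0 : 0 ≤ᵐ[ν] w)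
    (hΦ : ∀ φ, Integrable (Φ φ) ν) (hb : ∀ φ, ∀ᵐ s ∂ν, |Φ φ s| ≤ ‖φ‖ * w s)
    {C : Set (Set S)} (hgen : ‹MeasurableSpace S› = MeasurableSpace.generateFrom C)
    (hpi : IsPiSystem C) (huniv : univ ∈ C)
    (hC : ∀ E ∈ C, ∃ x : X, ∀ φ : StrongDual ℝ X, φ x = ∫ s in E, Φ φ s ∂ν)
    {E : Set S} (hE : MeasurableSet E) :
    ∃ x : X, ∀ φ : StrongDual ℝ X, φ x = ∫ s in E, Φ φ s ∂ν := by
  induction E, hE using MeasurableSpace.induction_on_inter hgen hpi with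
  | empty => exact ⟨0, by simp⟩
  | basic E hE => exact hC E hE
  | compl E hE ih =>
    obtain ⟨x, hx⟩ := ih
    obtain ⟨y, hy⟩ := hC univ huniv
    refine ⟨y - x, fun φ => ?_⟩
    rw [map_sub, hx, hy, setIntegral_univ, ← integral_add_compl hE (hΦ φ)]
    ring
  | iUnion E hd hE ih =>
    choose x hx using ih
    obtain ⟨y, -, hy⟩ := hasSum_of_forall_dual_setIntegral hw hw0 hΦ hb hE hd hx
    exact ⟨y, hy⟩

/-- In a space with the Radon-Nikodym property, a dominated family of densities of functionals
that has definite Pettis integrals over a generating `π`-system comes from a Bochner integrable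
function. -/
theorem HasRNP.exists_density (hX : HasRNP.{u, v} X) [IsProbabilityMeasure ν]
    (hw : Integrable w ν) (hw0 : 0 ≤ᵐ[ν] w)
    (hΦ : ∀ φ, Integrable (Φ φ) ν) (hb : ∀ φ, ∀ᵐ s ∂ν, |Φ φ s| ≤ ‖φ‖ * w s)
    {C : Set (Set S)} (hgen : ‹MeasurableSpace S› = MeasurableSpace.generateFrom C)
    (hpi : IsPiSystem C) (huniv : univ ∈ C)
    (hC : ∀ E ∈ C, ∃ x : X, ∀ φ : StrongDual ℝ X, φ x = ∫ s in E, Φ φ s ∂ν) :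
    ∃ g : S → X, Integrable g ν ∧ ∀ φ : StrongDual ℝ X, (fun s => φ (g s)) =ᵐ[ν] Φ φ := by
  classical
  choose! G hG using fun E (hE : MeasurableSet E) =>
    exists_forall_dual_setIntegral hw hw0 hΦ hb hgen hpi huniv hC hE
  have hext {x y : X} (h : ∀ φ : StrongDual ℝ X, φ x = φ y) : x = y :=
    (SeparatingDual.eq_iff_forall_dual_eq (R := ℝ)).2 h
  let V : VectorMeasure S X :=
    { measureOf' := fun E => if MeasurableSet E then G E else 0
      empty' := by
        rw [if_pos .empty]
        exact hext fun φ => by rw [hG ∅ .empty φ]; simp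
      not_measurable' := fun E hE => if_neg hE
      m_iUnion' := fun E hE hd => by
        obtain ⟨y, hs, hy⟩ := hasSum_of_forall_dual_setIntegral hw hw0 hΦ hb hE hd
          fun i => hG (E i) (hE i)
        simp only [hE, MeasurableSet.iUnion hE, if_true]
        rwa [hext (x := G (⋃ i, E i)) (y := y) fun φ => by rw [hG _ (.iUnion hE) φ, hy φ]] }
  have hV {E : Set S} (hE : MeasurableSet E) : V E = G E := if_pos hE
  have hbound : ∀ E, MeasurableSet E →
      ‖V E‖ₑ ≤ ν.withDensity (fun s => ENNReal.ofReal (w s)) E := by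
    intro E hE
    rw [hV hE, withDensity_apply _ hE, ← ofReal_norm,
      ← ofReal_integral_eq_lintegral_ofReal hw.integrableOn (ae_restrict_of_ae hw0)]
    exact ENNReal.ofReal_le_ofReal (norm_le_setIntegral_of_forall_dual hw hw0 hb (hG E hE))
  have hvar : V.variation univ < ∞ := by
    refine (VectorMeasure.variation_le_of_forall_enorm_le hbound univ).trans_lt ?_
    rw [withDensity_apply _ .univ, setLIntegral_univ]
    exact hw.lintegral_lt_top
  have hac : V ≪ᵥ ν.toENNRealVectorMeasure := by
    intro E h0
    by_cases hE : MeasurableSet E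
    · rw [Measure.toENNRealVectorMeasure_apply_measurable hE] at h0
      rw [hV hE]
      exact hext fun φ => by rw [hG E hE φ, setIntegral_measure_zero _ h0, map_zero]
    · exact V.not_measurable hE
  obtain ⟨g, hg, hVg⟩ := hX S ν V hvar hac
  refine ⟨g, hg, fun φ => ?_⟩
  refine Integrable.ae_eq_of_forall_setIntegral_eq _ _ (φ.integrable_comp hg) (hΦ φ)
    fun E hE _ => ?_
  rw [φ.integral_comp_comm hg.integrableOn, ← hVg E hE, hV hE, hG E hE φ]

end Density

/-! ### Weak neighbourhoods and weak limits -/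

section Weak

variable {X : Type v} [NormedAddCommGroup X] [NormedSpace ℝ X]

lemma exists_finset_of_mem_nhds_weakSpace {x : X} {V : Set (WeakSpace ℝ X)}
    (hV : V ∈ 𝓝 (toWeakSpace ℝ X x)) :
    ∃ (D : Finset (StrongDual ℝ X)) (ε : ℝ), 0 < ε ∧
      ∀ y, (∀ φ ∈ D, |φ (y - x)| < ε) → toWeakSpace ℝ X y ∈ V := by
  obtain ⟨D, ε, hε, hD⟩ := ((LinearMap.weakBilin_withSeminorms
    (topDualPairing ℝ X).flip).mem_nhds_iff (toWeakSpace ℝ X x) V).1 hV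
  refine ⟨D, ε, hε, fun y hy => hD ?_⟩
  exact (Seminorm.mem_ball _).2 (Seminorm.finset_sup_apply_lt hε fun φ hφ => hy φ hφ)

/-- Uniformity makes `D` independent of the base point. Letting `ε` run through `1 / (k + 1)` then
involves countably many functionals, hence one null set. -/
lemma WeakUniformContinuous.exists_finset {h : X → ℝ} (hh : WeakUniformContinuous h) {ε : ℝ}
    (hε : 0 < ε) : ∃ (D : Finset (StrongDual ℝ X)) (δ : ℝ), 0 < δ ∧
      ∀ x y, (∀ φ ∈ D, |φ (y - x)| < δ) → |h y - h x| < ε := by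
  have hh' := hh (Metric.dist_mem_uniformity hε)
  rw [Filter.mem_map, uniformity_eq_comap_nhds_zero'] at hh'
  obtain ⟨V, hV, hsub⟩ := hh'
  rw [← map_zero (toWeakSpace ℝ X)] at hV
  obtain ⟨D, δ, hδ, hD⟩ := exists_finset_of_mem_nhds_weakSpace hV
  refine ⟨D, δ, hδ, fun x y hxy => ?_⟩
  have := @hsub (toWeakSpace ℝ X x, toWeakSpace ℝ X y) (by
    have := hD (y - x) (by simpa using hxy)
    simpa [sub_eq_add_neg] using this)
  rw [← Real.dist_eq, dist_comm]
  simpa using this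

lemma WeakUniformContinuous.continuous {h : X → ℝ} (hh : WeakUniformContinuous h) :
    Continuous h := by
  rw [Metric.continuous_iff']
  intro x ε hε
  obtain ⟨D, δ, hδ, hD⟩ := hh.exists_finset hε
  have : ∀ᶠ y in 𝓝 x, ∀ φ ∈ D, |φ (y - x)| < δ := by
    rw [Filter.eventually_all_finset]
    intro φ _
    have : Tendsto (fun y => |φ (y - x)|) (𝓝 x) (𝓝 |φ (x - x)|) := by
      apply Continuous.tendsto; fun_prop
    refine this.eventually_lt_const ?_
    simpa using hδ
  filter_upwards [this] with y hy using hD x y hy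

variable {Ω : Type u} [MeasurableSpace (Ultrafilter Ω)] {P : Measure (Ultrafilter Ω)}
  {f : Ω → X} {g : Ultrafilter Ω → X}

/-- If `f` converges weakly to `g σ` along almost every ultrafilter `σ`, for each functional
separately, so does `h ∘ f` to `h (g σ)` for every weakly uniformly continuous `h`. -/
lemma WeakUniformContinuous.ae_tendsto {h : X → ℝ} (hh : WeakUniformContinuous h)
    (hfg : ∀ φ : StrongDual ℝ X, ∀ᵐ σ : Ultrafilter Ω ∂P,
      Tendsto (fun ω => φ (f ω)) (σ : Filter Ω) (𝓝 (φ (g σ)))) :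
    ∀ᵐ σ : Ultrafilter Ω ∂P, Tendsto (fun ω => h (f ω)) (σ : Filter Ω) (𝓝 (h (g σ))) := by
  choose D δ hδ hD using fun k : ℕ => hh.exists_finset (Nat.one_div_pos_of_nat (α := ℝ) (n := k))
  have hall : ∀ᵐ σ : Ultrafilter Ω ∂P, ∀ k, ∀ φ ∈ D k,
      Tendsto (fun ω => φ (f ω)) (σ : Filter Ω) (𝓝 (φ (g σ))) :=
    ae_all_iff.2 fun k => (ae_ball_iff (D k).countable_toSet).2 fun φ _ => hfg φ
  filter_upwards [hall] with σ hσ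
  rw [Metric.tendsto_nhds]
  intro ε hε
  obtain ⟨k, hk⟩ := exists_nat_one_div_lt hε
  have : ∀ᶠ ω in (σ : Filter Ω), ∀ φ ∈ D k, |φ (f ω - g σ)| < δ k := by
    rw [Filter.eventually_all_finset]
    intro φ hφ
    simpa [Real.dist_eq] using Metric.tendsto_nhds.1 (hσ k φ hφ) (δ k) (hδ k)
  filter_upwards [this] with ω hω
  exact (hD k _ _ hω).trans hk

/-- If `f` converges weakly to `g σ` along almost every ultrafilter `σ`, for each functional
separately, then `g σ` lies in `f '' A` for almost every `σ` containing `A`, provided that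
`f '' A` is weakly closed. -/
lemma ae_mem_image_of_isClosed (hg : StronglyMeasurable g)
    (hfg : ∀ φ : StrongDual ℝ X, ∀ᵐ σ : Ultrafilter Ω ∂P,
      Tendsto (fun ω => φ (f ω)) (σ : Filter Ω) (𝓝 (φ (g σ))))
    {A : Set Ω} (hA : IsClosed (toWeakSpace ℝ X '' (f '' A))) :
    ∀ᵐ σ : Ultrafilter Ω ∂P, A ∈ σ → g σ ∈ f '' A := by
  have hex (x : X) (hx : x ∈ (f '' A)ᶜ) : ∃ (D : Finset (StrongDual ℝ X)) (ε : ℝ), 0 < ε ∧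
      ∀ y, (∀ φ ∈ D, |φ (y - x)| < ε) → y ∉ f '' A := by
    have hn : (toWeakSpace ℝ X '' (f '' A))ᶜ ∈ 𝓝 (toWeakSpace ℝ X x) :=
      hA.isOpen_compl.mem_nhds (by simpa using hx)
    obtain ⟨D, ε, hε, hD⟩ := exists_finset_of_mem_nhds_weakSpace hn
    exact ⟨D, ε, hε, fun y hy hyA => hD y hy ⟨y, hyA, rfl⟩⟩
  choose! D ε hε hD using hex
  -- The `N x` are weak neighbourhoods missing `f '' A`. As `range g` is separable, countably many
  -- cover its part outside `f '' A`, so countably many functionals suffice.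
  let N : X → Set X := fun x => {y | ∀ φ ∈ D x, |φ (y - x)| < ε x}
  have hNo (x : X) : IsOpen (N x) := by
    have : N x = ⋂ φ ∈ D x, {y | |φ (y - x)| < ε x} := by ext; simp [N]
    rw [this]
    exact isOpen_biInter_finset fun φ _ => isOpen_lt (by fun_prop) continuous_const
  let T : Set X := range g ∩ (f '' A)ᶜ
  have := (hg.isSeparable_range.mono (inter_subset_left : T ⊆ _)).secondCountableTopology
  obtain ⟨t, ht, htU⟩ := TopologicalSpace.countable_cover_nhds (α := T)
    (f := fun x => Subtype.val ⁻¹' N x) fun x =>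
      ((hNo x).preimage continuous_subtype_val).mem_nhds (by
        simpa [N] using fun _ _ => hε x x.2.2)
  have hall : ∀ᵐ σ : Ultrafilter Ω ∂P, ∀ x ∈ t, ∀ φ ∈ D x,
      Tendsto (fun ω => φ (f ω)) (σ : Filter Ω) (𝓝 (φ (g σ))) :=
    (ae_ball_iff ht).2 fun x _ => (ae_ball_iff (D x).countable_toSet).2 fun φ _ => hfg φ
  filter_upwards [hall] with σ hσ hAσ
  by_contra hgσ
  have hmem : (⟨g σ, ⟨σ, rfl⟩, hgσ⟩ : T) ∈ ⋃ x ∈ t, Subtype.val ⁻¹' N x := htU ▸ mem_univ _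
  obtain ⟨x, hx, hxN⟩ := mem_iUnion₂.1 hmem
  have hev : ∀ᶠ ω in (σ : Filter Ω), ∀ φ ∈ D x, |φ (f ω - x)| < ε x := by
    rw [Filter.eventually_all_finset]
    intro φ hφ
    have h1 := ((hσ x hx φ hφ).sub_const (φ x)).abs
    simp only [← map_sub] at h1
    exact h1.eventually_lt_const (hxN φ hφ)
  obtain ⟨ω, hω, hωA⟩ := (hev.and hAσ).exists
  exact hD x x.2.2 (f ω) hω ⟨ω, hωA, rfl⟩

end Weak

/-! ### The weak limit of `f` and its values -/

namespace FinAdd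

variable {Ω : Type u} {𝒜 : Set (Set Ω)} {m : AddContent ℝ≥0 𝒜}
  {X : Type v} [NormedAddCommGroup X] [NormedSpace ℝ X] {f : Ω → X}

lemma PettisIntegrable.integrable_dual (hf : PettisIntegrable m f) (h𝒜 : IsSetAlgebra 𝒜)
    (φ : StrongDual ℝ X) : Integrable m fun ω => φ (f ω) := by
  obtain ⟨x, hx⟩ := hf univ h𝒜.univ_mem
  simpa using (hx φ).integrable

variable [MeasurableSpace (Ultrafilter Ω)] {P : Measure (Ultrafilter Ω)}

/-- A norm and Pettis integrable function with values in a space with the Radon-Nikodym property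
converges along ultrafilters, for each functional almost surely, to a Bochner integrable one. -/
lemma PettisIntegrable.exists_tendsto [CompleteSpace X] [IsProbabilityMeasure P]
    (hX : HasRNP.{u, v} X) (h𝒜 : IsSetAlgebra 𝒜) (hP : IsStoneMeasure m P)
    (hf_norm : Integrable m fun ω => ‖f ω‖) (hf : PettisIntegrable m f) :
    ∃ g : Ultrafilter Ω → X, StronglyMeasurable g ∧ ∀ φ : StrongDual ℝ X,
      ∀ᵐ σ : Ultrafilter Ω ∂P, Tendsto (fun ω => φ (f ω)) (σ : Filter Ω) (𝓝 (φ (g σ))) := by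
  have hw := hf_norm.hat h𝒜 hP
  have hΦ (φ : StrongDual ℝ X) := (hf.integrable_dual h𝒜 φ).hat h𝒜 hP
  have hw0 : 0 ≤ᵐ[P] hat fun ω => ‖f ω‖ := by
    filter_upwards [hw.2.1] with σ hσ
    exact ge_of_tendsto' hσ fun ω => norm_nonneg _
  have hb (φ : StrongDual ℝ X) : ∀ᵐ σ : Ultrafilter Ω ∂P,
      |hat (fun ω => φ (f ω)) σ| ≤ ‖φ‖ * hat (fun ω => ‖f ω‖) σ := by
    filter_upwards [hw.2.1, (hΦ φ).2.1] with σ h1 h2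
    exact le_of_tendsto_of_tendsto' h2.abs (h1.const_mul _) fun ω => φ.le_opNorm (f ω)
  have hC := isSetAlgebra_cyl h𝒜
  obtain ⟨g, hg, hgΦ⟩ := hX.exists_density hw.1 hw0 (fun φ => (hΦ φ).1) hb hP.generate
    (fun s hs t ht _ => hC.inter_mem hs ht) hC.univ_mem (by
      rintro _ ⟨A, hA, rfl⟩
      obtain ⟨x, hx⟩ := hf A hA
      exact ⟨x, fun φ => ((hx φ).setIntegral_hat h𝒜 hP (hf.integrable_dual h𝒜 φ) hA).symm⟩)
  -- A strongly measurable version has separable range everywhere, as the Lindelöf argument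
  -- requires.
  refine ⟨hg.aestronglyMeasurable.mk g, hg.aestronglyMeasurable.stronglyMeasurable_mk,
    fun φ => ?_⟩
  filter_upwards [(hΦ φ).2.1, hgΦ φ, hg.aestronglyMeasurable.ae_eq_mk] with σ h1 h2 h3
  rwa [← h3, h2]

/-- The weak limits of `f` along ultrafilters are values of `f` on countably many sets with weakly
closed images, almost surely. -/
lemma EssWeaklyClosedRange.exists_ae_mem (hf : EssWeaklyClosedRange m f) (h𝒜 : IsSetAlgebra 𝒜)
    (hP : IsStoneMeasure m P) {g : Ultrafilter Ω → X} (hg : StronglyMeasurable g)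
    (hfg : ∀ φ : StrongDual ℝ X, ∀ᵐ σ : Ultrafilter Ω ∂P,
      Tendsto (fun ω => φ (f ω)) (σ : Filter Ω) (𝓝 (φ (g σ)))) :
    ∃ A : ℕ → Set Ω, (∀ n, IsClosed (f '' A n)) ∧ ∀ᵐ σ ∂P, g σ ∈ ⋃ n, f '' A n := by
  choose A hA hm hcl using hf
  refine ⟨A, fun n => ?_, ?_⟩
  -- Weakly closed sets are norm closed, hence Borel.
  · have := (hcl n).preimage (toWeakSpaceCLM ℝ X).continuous
    rwa [show ⇑(toWeakSpaceCLM ℝ X) = toWeakSpace ℝ X from rfl,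
      preimage_image_eq _ (toWeakSpace ℝ X).injective] at this
  · have hle (n : ℕ) : P {σ | g σ ∉ ⋃ n, f '' A n} ≤ ((2⁻¹ : ℝ≥0) ^ n : ℝ≥0) := by
      calc P {σ | g σ ∉ ⋃ n, f '' A n} ≤ P (cyl (A n)ᶜ) := by
            refine measure_mono_ae ?_
            filter_upwards [ae_mem_image_of_isClosed hg hfg (hcl n)] with σ hσ hgσ
            exact Ultrafilter.compl_mem_iff_notMem.2 fun h => hgσ (mem_iUnion.2 ⟨n, hσ h⟩)
        _ = m (A n)ᶜ := hP.measure_cyl _ (h𝒜.compl_mem (hA n))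
        _ ≤ _ := by exact_mod_cast (hm n).le
    have hlim : Tendsto (fun n : ℕ => (((2⁻¹ : ℝ≥0) ^ n : ℝ≥0) : ℝ≥0∞)) atTop (𝓝 0) := by
      rw [← ENNReal.coe_zero, ENNReal.tendsto_coe]
      exact tendsto_pow_atTop_nhds_zero_of_lt_one zero_le
        (by rw [← NNReal.coe_lt_coe]; norm_num)
    exact le_antisymm (ge_of_tendsto' hlim hle) zero_le

end FinAdd

/-! ### Lifting to `Ω` and conclusion -/

/-- A measurable map with values almost surely in a measurable subset of the range of `f` lifts
through `f`, almost surely. -/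
lemma exists_measurable_lift {S Ω X : Type*} [MeasurableSpace S] [MeasurableSpace X] [Nonempty Ω]
    {P : Measure S} {f : Ω → X} {g : S → X} (hg : Measurable g) {F : Set X} (hF : MeasurableSet F)
    (hFf : F ⊆ range f) (hgF : ∀ᵐ s ∂P, g s ∈ F) :
    ∃ κ : S → Ω, @Measurable _ _ _ (MeasurableSpace.comap f inferInstance) κ ∧
      ∀ᵐ s ∂P, f (κ s) = g s := by
  classical
  -- The selection `k` need not be measurable: for the σ-algebra pulled back by `f`, only `f ∘ κ`
  -- matters, and it is `g` on `g ⁻¹' F` and constant elsewhere.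
  choose! k hk using fun x (hx : x ∈ F) => hFf hx
  inhabit Ω
  let κ : S → Ω := (g ⁻¹' F).piecewise (fun s => k (g s)) fun _ => default
  have hfκ : f ∘ κ = (g ⁻¹' F).piecewise g fun _ => f default := by
    ext s
    by_cases hs : g s ∈ F <;> simp [κ, piecewise, hs, hk]
  refine ⟨κ, ?_, ?_⟩
  · rw [measurable_iff_comap_le, MeasurableSpace.comap_comp, ← measurable_iff_comap_le, hfκ]
    exact hg.piecewise (hg hF) measurable_const
  · filter_upwards [hgF] with s hs
    simp [κ, hs, hk]

theorem theorem6p2 {Ω : Type u} {X : Type v}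
    [NormedAddCommGroup X] [NormedSpace ℝ X] [CompleteSpace X]
    (hX : HasRNP.{u, v} X)
    (𝒜 : Set (Set Ω)) (h𝒜 : IsSetAlgebra 𝒜)
    (m : AddContent ℝ≥0 𝒜) (hm : m univ = 1)
    (f : Ω → X)
    (hf_norm : FinAdd.Integrable m fun ω => ‖f ω‖)
    (hf_pettis : FinAdd.PettisIntegrable m f)
    (hf_range : FinAdd.EssWeaklyClosedRange m f) :
    ∃ μ : @Measure Ω ((borel X).comap f), IsProbabilityMeasure μ ∧
      ∀ h : X → ℝ, WeakUniformContinuous h → FinAdd.Integrable m (fun ω => h (f ω)) →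
        MeasureTheory.Integrable (fun ω => h (f ω)) μ ∧
        FinAdd.HasIntegral m (fun ω => h (f ω)) (∫ ω, h (f ω) ∂μ) := by
  obtain ⟨_, P, hP⟩ := FinAdd.exists_isStoneMeasure h𝒜 m
  have := hP.isProbabilityMeasure h𝒜 hm
  have : Nonempty Ω := by
    by_contra hΩ
    rw [not_nonempty_iff] at hΩ
    simp [univ_eq_empty_iff.2 hΩ] at hm
  borelize X
  let _ : MeasurableSpace Ω := (borel X).comap f
  obtain ⟨g, hg, hfg⟩ := hf_pettis.exists_tendsto hX h𝒜 hP hf_norm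
  obtain ⟨A, hA, hgA⟩ := hf_range.exists_ae_mem h𝒜 hP hg hfg
  obtain ⟨κ, hκ, hκg⟩ := exists_measurable_lift hg.measurable
    (MeasurableSet.iUnion fun n => (hA n).measurableSet)
    (iUnion_subset fun n => image_subset_range f (A n)) hgA
  refine ⟨P.map κ, Measure.isProbabilityMeasure_map hκ.aemeasurable, fun h hh hi => ?_⟩
  obtain ⟨h1, h2, h3⟩ := hi.hat h𝒜 hP
  have hhf : Measurable fun ω => h (f ω) :=
    hh.continuous.measurable.comp (comap_measurable f)
  have hae : (fun σ => h (f (κ σ))) =ᵐ[P] FinAdd.hat fun ω => h (f ω) := by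
    filter_upwards [hκg, hh.ae_tendsto hfg] with σ h4 h5
    rw [h4, FinAdd.hat_eq h5]
  refine ⟨(integrable_map_measure hhf.aestronglyMeasurable hκ.aemeasurable).2 (h1.congr hae.symm),
    ?_⟩
  rwa [integral_map hκ.aemeasurable hhf.aestronglyMeasurable, integral_congr_ae hae]
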